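/- Let $X$ be a complex Banach space and let $A$ be a sectorial operator on $X$, that is, a densely defined linear operator $A:\operatorname{dom}(A)\subset X\to X$ with $\sigma(A)\subset\mathbb C\setminus(-\infty,0)$ and $\sup_{s>0}\|(1+sA)^{-1}\|<\infty$. (For $s=0$ we read $(1+sA)^{-1}$ as the identity operator of $X$.) For an integer $n\ge 1$ let $\tilde{\mathcal S}_{n,b}$ be the set of functions $f:(0,\infty)\to\mathbb C$ of the form $$f(z)=\int_{[0,\infty)}\frac{\nu(ds)}{(1+zs)^n},\qquad z>0, \tag{1}$$ where $\nu$ is a complex Radon measure of finite total variation on $[0,\infty)$, and let $\tilde{\mathcal S}_b=\bigcup_{n\ge1}\tilde{\mathcal S}_{n,b}$ (the bounded Stieltjes algebra). Then $\tilde{\mathcal S}_b$ is a unital subalgebra of the algebra of all functions $(0,\infty)\to\mathbb C$, and there is exactly one unital algebra homomorphism $S:\tilde{\mathcal S}_b\to\mathcal L(X)$, $f\mapsto f(A)$, such that $$f(A)x=\int_{[0,\infty)}(1+sA)^{-n}x\,\nu(ds),\qquad x\in X,$$ for all $n\ge1$, all complex measures $\nu$ as above and all $f\in\tilde{\mathcal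 S}_b$ for which (1) holds, the integrand on the right always being Bochner integrable with respect to $|\nu|$. In particular $f(A)$ does not depend on the choice of $n$ and $\nu$ in (1), and $(fg)(A)=f(A)g(A)$ for all $f,g\in\tilde{\mathcal S}_b$. -/

import Mathlib

open MeasureTheory
open scoped NNReal

noncomputable section

namespace StieltjesCalculus

/-! ### Unbounded operators and sectoriality -/

/-- The bounded, everywhere defined operator `R` is the two-sided inverse of the (possibly
unbounded) operator `B`: `R (B x) = x` for `x ∈ dom B`, and for all `y` one has `R y ∈ dom B` and
`B (R y) = y`. -/
def IsBoundedInverse {X : Type*} [NormedAddCommGroup X] [NormedSpace ℂ X]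
    (B : X →ₗ.[ℂ] X) (R : X →L[ℂ] X) : Prop :=
  (∀ x : B.domain, R (B x) = x) ∧ ∀ y : X, ∃ x : B.domain, R y = x ∧ B x = y

/-- A bounded inverse is unique. -/
theorem IsBoundedInverse.unique {X : Type*} [NormedAddCommGroup X] [NormedSpace ℂ X]
    {B : X →ₗ.[ℂ] X} {R R' : X →L[ℂ] X}
    (h : IsBoundedInverse B R) (h' : IsBoundedInverse B R') : R = R' := by
  ext y
  obtain ⟨x, hx, hy⟩ := h.2 y
  rw [hx, ← hy, h'.1 x]

/-- The operator `a + b A` with domain `dom A`. -/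
def affine {X : Type*} [NormedAddCommGroup X] [NormedSpace ℂ X]
    (a b : ℂ) (A : X →ₗ.[ℂ] X) : X →ₗ.[ℂ] X where
  domain := A.domain
  toFun := a • A.domain.subtype + b • A.toFun

/-- The spectrum of an unbounded operator `A`: the set of `l` such that `l - A` has no bounded
everywhere defined inverse. -/
def opSpectrum {X : Type*} [NormedAddCommGroup X] [NormedSpace ℂ X]
    (A : X →ₗ.[ℂ] X) : Set ℂ :=
  {l : ℂ | ¬ ∃ R : X →L[ℂ] X, IsBoundedInverse (affine l (-1) A) R}

open Classical in
/-- The bounded operator `(1 + s A)⁻¹` for `s ≥ 0`. For `s > 0` it is the bounded inverse of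
`1 + s A` (and `0` if there is none, which does not happen when `A` is sectorial); for `s = 0` it is
the identity operator of `X`. -/
def res {X : Type*} [NormedAddCommGroup X] [NormedSpace ℂ X]
    (A : X →ₗ.[ℂ] X) (s : ℝ≥0) : X →L[ℂ] X :=
  if s = 0 then 1
  else if h : ∃ R : X →L[ℂ] X, IsBoundedInverse (affine 1 (s : ℝ) A) R then h.choose
  else 0

/-- `A` is sectorial (non-negative): densely defined, `σ(A) ⊆ ℂ \ (-∞, 0)` and
`sup_{s > 0} ‖(1 + s A)⁻¹‖ < ∞`. -/
structure IsSectorial {X : Type*} [NormedAddCommGroup X] [NormedSpace ℂ X]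
    (A : X →ₗ.[ℂ] X) : Prop where
  dense_domain : Dense (A.domain : Set X)
  spectrum_subset : ∀ l ∈ opSpectrum A, ¬ ∃ t : ℝ, t < 0 ∧ l = t
  bounded : ∃ M : ℝ, ∀ s : ℝ≥0, 0 < s → ‖res A s‖ ≤ M

/-! ### The bounded Stieltjes algebra -/

/-- The integral `∫_{[0,∞)} f(s) ν(ds)` of a vector-valued function with respect to a complex
measure. -/
def cintegral {E : Type*} [NormedAddCommGroup E] [NormedSpace ℂ E]
    (ν : ComplexMeasure ℝ≥0) (f : ℝ≥0 → E) : E :=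
  ν.integral f (ContinuousLinearMap.lsmul ℝ ℂ).flip

/-- `f(z) = ∫_{[0,∞)} ν(ds) / (1 + z s)^n` for all `z > 0`. -/
def Represents (n : ℕ) (ν : ComplexMeasure ℝ≥0) (f : Set.Ioi (0 : ℝ) → ℂ) : Prop :=
  ∀ z : Set.Ioi (0 : ℝ), f z = cintegral ν fun s => 1 / (1 + ((z : ℝ) : ℂ) * ((s : ℝ) : ℂ)) ^ n

/-- The class of functions `f : (0, ∞) → ℂ` of the form `f(z) = ∫_{[0,∞)} ν(ds) / (1 + z s)^n`,
where `ν` is a complex Borel measure on `[0, ∞)` (such a measure is automatically Radon and of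
finite total variation). -/
def boundedStieltjesOrder (n : ℕ) : Set (Set.Ioi (0 : ℝ) → ℂ) :=
  {f | ∃ ν : ComplexMeasure ℝ≥0, Represents n ν f}

/-- The union of the classes `boundedStieltjesOrder n` over the integers `n ≥ 1`. -/
def boundedStieltjes : Set (Set.Ioi (0 : ℝ) → ℂ) :=
  {f | ∃ n : ℕ, 1 ≤ n ∧ f ∈ boundedStieltjesOrder n}

end StieltjesCalculus

end

namespace StieltjesCalculus

/-! ### Densities of complex measures -/

/-! Everything rests on the resolvent identity, boundedness and strong continuity, which
`IsResolventFamily` isolates. Two families have these properties: `s ↦ (1 + sA)⁻¹` on `X`, and for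
each `z > 0` multiplication by `(1 + zs)⁻¹` on `ℂ`. Whatever holds for all such families therefore
holds for operators and for functions at once.

The main identity is `R p ^ n * R t = ∫₀¹ n u ^ (n - 1) R (u p + (1 - u) t) ^ (n + 1) du`, applied
pointwise (`pow_mul_apply_eq_integral`). Iterating it writes `R p ^ n * R t ^ m` as an average of
powers of order `n + m`. By Fubini, a product of transforms of `ν` and `ν'` is the transform of
`mulMeasure n ν m ν'`, a measure that does not involve `R` (`transform_mulMeasure`). The scalar
families then give closure of the class under products, and the operator family gives `(fg)(A) =
f(A)g(A)` with the same measure. The unit mass at `0` represents `1` in every order, so multiplying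
by it raises the order; this also yields sums.

Independence of the representation: two representations of `f`, of orders `n` and `m`, are raised to
order `n + m`, where the measure is unique (`eq_zero_of_represents_zero`), and raising does not
change the operator. Uniqueness of the measure follows by differentiating in `z` to obtain all
higher orders, reading these at `z = 1` as vanishing moments, and applying Weierstrass
approximation. Uniqueness of the homomorphism is immediate, because its values are prescribed. -/

/-- A finite positive measure dominating the complex measure `ν`. -/
noncomputable def dominating {Ω : Type*} [MeasurableSpace Ω] (ν : ComplexMeasure Ω) : Measure Ω :=
  ν.re.totalVariation + ν.im.totalVariation

instance {Ω : Type*} [MeasurableSpace Ω] (ν : ComplexMeasure Ω) :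
    IsFiniteMeasure (dominating ν) := by
  unfold dominating SignedMeasure.totalVariation
  infer_instance

/-- The density of the complex measure `ν` with respect to `dominating ν`. -/
noncomputable def density {Ω : Type*} [MeasurableSpace Ω] (ν : ComplexMeasure Ω) : Ω → ℂ :=
  ν.rnDeriv (dominating ν)

theorem integrable_density {Ω : Type*} [MeasurableSpace Ω] (ν : ComplexMeasure Ω) :
    Integrable (density ν) (dominating ν) :=
  ν.integrable_rnDeriv _

theorem withDensity_rnDeriv_of_totalVariation_le {Ω : Type*} [MeasurableSpace Ω]
    (ν : SignedMeasure Ω) (μ : Measure Ω) [IsFiniteMeasure μ] (h : ν.totalVariation ≤ μ) :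
    μ.withDensityᵥ (ν.rnDeriv μ) = ν := by
  apply SignedMeasure.withDensityᵥ_rnDeriv_eq
  rw [SignedMeasure.absolutelyContinuous_ennreal_iff,
    VectorMeasure.ennrealToMeasure_toENNRealVectorMeasure]
  exact Measure.absolutelyContinuous_of_le h

/-- The real and imaginary parts are absolutely continuous with respect to the dominating measure,
so Radon–Nikodym applies to each. -/
theorem withDensity_density {Ω : Type*} [MeasurableSpace Ω] (ν : ComplexMeasure Ω) :
    (dominating ν).withDensityᵥ (density ν) = ν := by
  have hre := withDensity_rnDeriv_of_totalVariation_le ν.re (dominating ν)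
    (Measure.le_add_right le_rfl)
  have him := withDensity_rnDeriv_of_totalVariation_le ν.im (dominating ν)
    (Measure.le_add_left le_rfl)
  have hi := integrable_density ν
  ext s hs
  rw [withDensityᵥ_apply hi hs]
  apply Complex.ext
  · rw [← RCLike.re_eq_complex_re, ← integral_re hi.integrableOn]
    have h := DFunLike.congr_fun hre s
    rwa [withDensityᵥ_apply (SignedMeasure.integrable_rnDeriv _ _) hs] at h
  · rw [← RCLike.im_eq_complex_im, ← integral_im hi.integrableOn]
    have h := DFunLike.congr_fun him s
    rwa [withDensityᵥ_apply (SignedMeasure.integrable_rnDeriv _ _) hs] at h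

theorem isFiniteMeasure_variation_withDensity {Ω : Type*} [MeasurableSpace Ω] {P : Measure Ω}
    {h : Ω → ℂ} (hh : Integrable h P) : IsFiniteMeasure (P.withDensityᵥ h).variation := by
  rw [Measure.variation_withDensityᵥ hh]
  exact isFiniteMeasure_withDensity hh.2.ne

/-! ### Integrals against complex measures as Bochner integrals -/

section Integral

variable {E : Type*} [NormedAddCommGroup E] [NormedSpace ℂ E]

theorem integrable_smul_of_integrable_withDensity {Ω : Type*} [MeasurableSpace Ω] {P : Measure Ω} {h : Ω → ℂ}
    (hh : Integrable h P) {f : Ω → E} (hf : (P.withDensityᵥ h).Integrable f) :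
    Integrable (fun ω => h ω • f ω) P := by
  rw [VectorMeasure.Integrable, Measure.variation_withDensityᵥ hh] at hf
  obtain ⟨h', hm, hae⟩ := hh.aestronglyMeasurable
  have e : P.withDensity (fun x => ‖h x‖ₑ) = P.withDensity (fun x => (‖h' x‖₊ : ENNReal)) :=
    withDensity_congr_ae (hae.mono fun x hx => by simp [hx, enorm_eq_nnnorm])
  rw [e, integrable_withDensity_iff_integrable_smul₀ hm.measurable.nnnorm.aemeasurable] at hf
  have hm2 : AEStronglyMeasurable (fun ω => h' ω • f ω) P := by
    -- `f` need not be measurable where the density vanishes; only `‖h'‖ f` is known to be. The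
    -- phase `h' / ‖h'‖` recovers the product, with `0 / 0 = 0` harmless there.
    have : (fun ω => h' ω • f ω) = fun ω => (h' ω / ‖h' ω‖) • (‖h' ω‖₊ • f ω) := by
      ext ω
      by_cases h0 : h' ω = 0
      · simp [h0]
      · have : ((‖h' ω‖ : ℝ) : ℂ) ≠ 0 := by simpa using h0
        rw [NNReal.smul_def, ← Complex.coe_smul, smul_smul, coe_nnnorm, div_mul_cancel₀ _ this]
    rw [this]
    refine AEStronglyMeasurable.smul ?_ hf.aestronglyMeasurable
    exact (hm.measurable.div
      (Complex.measurable_ofReal.comp hm.measurable.norm)).aestronglyMeasurable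
  have : Integrable (fun ω => h' ω • f ω) P :=
    hf.mono hm2 (.of_forall fun ω => by rw [NNReal.smul_def, norm_smul, norm_smul]; simp)
  exact this.congr (hae.mono fun x hx => by simp [hx])

variable [CompleteSpace E]

/-- Integration against a measure with density. -/
theorem integral_withDensity {Ω : Type*} [MeasurableSpace Ω] {P : Measure Ω} {h : Ω → ℂ}
    (hh : Integrable h P) {f : Ω → E} (hf : (P.withDensityᵥ h).Integrable f) :
    (P.withDensityᵥ h).integral f (ContinuousLinearMap.lsmul ℝ ℂ).flip = ∫ ω, h ω • f ω ∂P := by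
  have hvar := Measure.variation_withDensityᵥ hh
  have hfin := isFiniteMeasure_variation_withDensity hh
  have hae : ∀ {f g : Ω → E}, f =ᵐ[(P.withDensityᵥ h).variation] g →
      (fun ω => h ω • f ω) =ᵐ[P] fun ω => h ω • g ω := by
    intro f g hfg
    rw [hvar, Filter.EventuallyEq, ae_withDensity_iff' hh.aestronglyMeasurable.enorm] at hfg
    filter_upwards [hfg] with ω hω
    by_cases h0 : h ω = 0
    · simp [h0]
    · rw [hω (by simpa using h0)]
  refine Integrable.induction (μ := (P.withDensityᵥ h).variation) (fun f : Ω → E =>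
    (P.withDensityᵥ h).integral f (ContinuousLinearMap.lsmul ℝ ℂ).flip = ∫ ω, h ω • f ω ∂P)
    ?_ ?_ ?_ ?_ hf
  · intro c s hs _
    have hsm : (fun ω => h ω • s.indicator (fun _ => c) ω) = s.indicator fun ω => h ω • c := by
      ext ω
      by_cases hω : ω ∈ s <;> simp [hω]
    rw [VectorMeasure.integral_indicator hs, hsm, integral_indicator hs, integral_smul_const,
      VectorMeasure.integral_const]
    simp [VectorMeasure.restrict_apply, hs, withDensityᵥ_apply hh hs]
  · intro f g _ hf hg ihf ihg
    rw [VectorMeasure.integral_add hf hg, ihf, ihg,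
      ← integral_add (integrable_smul_of_integrable_withDensity hh hf) (integrable_smul_of_integrable_withDensity hh hg)]
    simp
  · refine isClosed_eq VectorMeasure.continuous_integral ?_
    -- The variation of the measure has density `‖h‖`, so the right side is a contraction on `L¹` of
    -- the variation.
    refine LipschitzWith.continuous (K := 1) (LipschitzWith.of_dist_le_mul fun f g => ?_)
    have hf := L1.integrable_coeFn f
    have hg := L1.integrable_coeFn g
    rw [dist_eq_norm, dist_eq_norm, ← integral_sub (integrable_smul_of_integrable_withDensity hh hf)
      (integrable_smul_of_integrable_withDensity hh hg), L1.norm_eq_integral_norm,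
      integral_congr_ae ((Lp.coeFn_sub f g).mono fun ω hω => congrArg norm hω), NNReal.coe_one,
      one_mul]
    refine (norm_integral_le_integral_norm _).trans (le_of_eq ?_)
    have key (k : Ω → ℝ) : ∫ ω, k ω ∂(P.withDensityᵥ h).variation = ∫ ω, ‖h ω‖ * k ω ∂P := by
      rw [hvar, integral_withDensity_eq_integral_toReal_smul₀ hh.aestronglyMeasurable.enorm
        (.of_forall fun _ => enorm_lt_top)]
      simp
    rw [key]
    refine integral_congr_ae (.of_forall fun ω => ?_)
    simp [← smul_sub, norm_smul]
  · intro f g hfg _ ih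
    rw [← VectorMeasure.integral_congr_ae hfg, ih, integral_congr_ae (hae hfg)]

end Integral

instance {Ω : Type*} [MeasurableSpace Ω] (ν : ComplexMeasure Ω) :
    IsFiniteMeasure ν.variation := by
  rw [← withDensity_density ν]
  exact isFiniteMeasure_variation_withDensity (integrable_density ν)

section Bounded

variable {E : Type*} [NormedAddCommGroup E]

theorem integrable_of_norm_le {Ω : Type*} [MeasurableSpace Ω] (ν : ComplexMeasure Ω) {f : Ω → E}
    (hf : StronglyMeasurable f) {C : ℝ} (hC : ∀ ω, ‖f ω‖ ≤ C) : ν.Integrable f :=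
  Integrable.of_bound hf.aestronglyMeasurable C (.of_forall hC)

variable [NormedSpace ℂ E]

theorem integrable_density_smul (ν : ComplexMeasure ℝ≥0) {f : ℝ≥0 → E}
    (hf : ν.Integrable f) :
    Integrable (fun s => density ν s • f s) (dominating ν) :=
  integrable_smul_of_integrable_withDensity (integrable_density ν)
    (by rwa [withDensity_density])

theorem cintegral_add {ν ν' : ComplexMeasure ℝ≥0} {f : ℝ≥0 → E} (hf : ν.Integrable f)
    (hf' : ν'.Integrable f) :
    cintegral (ν + ν') f = cintegral ν f + cintegral ν' f :=
  VectorMeasure.integral_add_vectorMeasure hf hf'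

variable [CompleteSpace E]

theorem cintegral_eq_integral_density (ν : ComplexMeasure ℝ≥0) {f : ℝ≥0 → E}
    (hf : ν.Integrable f) :
    cintegral ν f = ∫ s, density ν s • f s ∂dominating ν := by
  have h := integral_withDensity (f := f) (integrable_density ν)
    (by rwa [withDensity_density])
  rwa [withDensity_density] at h

theorem cintegral_map_withDensity {Ω : Type*} [MeasurableSpace Ω] {P : Measure Ω} {h : Ω → ℂ}
    (hh : Integrable h P) {φ : Ω → ℝ≥0} (hφ : Measurable φ) {f : ℝ≥0 → E}
    (hf : StronglyMeasurable f) {C : ℝ} (hC : ∀ s, ‖f s‖ ≤ C) :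
    cintegral ((P.withDensityᵥ h).map φ) f = ∫ ω, h ω • f (φ ω) ∂P := by
  have hi : (P.withDensityᵥ h).Integrable (f ∘ φ) :=
    integrable_of_norm_le _ (hf.comp_measurable hφ) fun ω => hC (φ ω)
  rw [cintegral, VectorMeasure.integral_map hφ hf.aestronglyMeasurable hi]
  exact integral_withDensity hh hi

theorem cintegral_smul (c : ℂ) (ν : ComplexMeasure ℝ≥0) {f : ℝ≥0 → E}
    (hf : StronglyMeasurable f) {C : ℝ} (hC : ∀ s, ‖f s‖ ≤ C) :
    cintegral (c • ν) f = c • cintegral ν f := by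
  have hi := integrable_density ν
  have e : c • ν = (dominating ν).withDensityᵥ (c • density ν) := by
    rw [withDensityᵥ_smul, withDensity_density]
  rw [cintegral_eq_integral_density ν (integrable_of_norm_le ν hf hC), cintegral, e,
    integral_withDensity (hi.smul c) (integrable_of_norm_le _ hf hC), ← integral_smul]
  simp [smul_smul]

theorem cintegral_dirac (f : ℝ≥0 → E) :
    cintegral (VectorMeasure.dirac 0 1) f = f 0 := by
  rw [cintegral, VectorMeasure.integral_dirac]
  simp

end Bounded

/-! ### Resolvent families -/

/-- A bounded, strongly continuous family `R s`, `s ≥ 0`, of operators satisfying the identities of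
`(1 + s A)⁻¹`. -/
structure IsResolventFamily {X : Type*} [NormedAddCommGroup X] [NormedSpace ℂ X]
    (R : ℝ≥0 → X →L[ℂ] X) : Prop where
  zero : R 0 = 1
  identity : ∀ s t : ℝ≥0, ((t : ℝ) : ℂ) • R t - ((s : ℝ) : ℂ) • R s =
    ((t : ℝ) - (s : ℝ) : ℂ) • (R s * R t)
  bounded : ∃ M : ℝ, ∀ s, ‖R s‖ ≤ M
  tendsto_zero : ∀ x, Filter.Tendsto (fun s => R s x) (nhds 0) (nhds x)

namespace IsResolventFamily

variable {X : Type*} [NormedAddCommGroup X] [NormedSpace ℂ X] {R : ℝ≥0 → X →L[ℂ] X}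

/-- Exchanging `s` and `t` in the resolvent identity negates both the left side and the scalar
factor. -/
theorem commute (hR : IsResolventFamily R) (s t : ℝ≥0) : Commute (R s) (R t) := by
  rcases eq_or_ne s t with rfl | hst
  · exact Commute.refl _
  have h1 := hR.identity s t
  have h2 := hR.identity t s
  have hne : ((t : ℝ) - (s : ℝ) : ℂ) ≠ 0 := by
    rw [sub_ne_zero]
    exact_mod_cast hst.symm
  refine smul_right_injective (X →L[ℂ] X) hne ?_
  change _ • _ = _ • _
  rw [← h1, ← neg_sub ((s : ℝ) : ℂ), neg_smul, ← h2, neg_sub]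

/-- The derivative of `v ↦ (1 + v A)⁻¹` at `v > 0`. -/
theorem hasDerivAt (hR : IsResolventFamily R) {v : ℝ} (hv : 0 < v) :
    HasDerivAt (fun v : ℝ => R v.toNNReal)
      ((v⁻¹ : ℝ) • (R v.toNNReal ^ 2 - R v.toNNReal)) v := by
  obtain ⟨M, hM⟩ := hR.bounded
  set V := fun v : ℝ => R v.toNNReal with hV
  -- For `Q v = v V v` the resolvent identity reads `Q b - Q a = (b - a) V a V b`. Boundedness makes
  -- `Q`, hence `V`, continuous at `v`; the difference quotients of `Q` then converge to `V v * V
  -- v`.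
  set Q := fun v : ℝ => v • V v with hQ
  have hid : ∀ {a b : ℝ}, 0 < a → 0 < b → Q b - Q a = (b - a) • (V a * V b) := by
    intro a b ha hb
    have := hR.identity a.toNNReal b.toNNReal
    rw [Real.coe_toNNReal _ ha.le, Real.coe_toNNReal _ hb.le] at this
    simp only [hQ, hV, ← Complex.coe_smul]
    rw [this]
    push_cast
    rfl
  have hpos : ∀ᶠ w in nhds v, 0 < w := lt_mem_nhds hv
  have hQc : ContinuousAt Q v := by
    rw [ContinuousAt, tendsto_iff_norm_sub_tendsto_zero]
    have hlim : Filter.Tendsto (fun w => |w - v| * (M * M)) (nhds v) (nhds 0) := by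
      have : Continuous fun w => |w - v| * (M * M) := by fun_prop
      simpa using this.tendsto v
    refine squeeze_zero' (.of_forall fun _ => norm_nonneg _) ?_ hlim
    filter_upwards [hpos] with w hw
    rw [hid hv hw, norm_smul, Real.norm_eq_abs]
    gcongr
    refine (norm_mul_le _ _).trans ?_
    gcongr
    · exact (norm_nonneg _).trans (hM 0)
    · exact hM _
    · exact hM _
  have hVQ : V =ᶠ[nhds v] fun w => w⁻¹ • Q w := by
    filter_upwards [hpos] with w hw
    simp [hQ, smul_smul, hw.ne']
  have hVc : ContinuousAt V v :=
    (((continuousAt_inv₀ hv.ne').smul hQc).congr hVQ.symm)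
  have hQd : HasDerivAt Q (V v * V v) v := by
    rw [hasDerivAt_iff_tendsto_slope]
    have : Filter.Tendsto (fun w => V v * V w) (nhdsWithin v {v}ᶜ) (nhds (V v * V v)) :=
      (continuousAt_const.mul hVc).tendsto.mono_left nhdsWithin_le_nhds
    refine this.congr' ?_
    filter_upwards [self_mem_nhdsWithin, nhdsWithin_le_nhds hpos] with w hw hw0
    rw [slope_def_module, hid hv hw0, smul_smul, inv_mul_cancel₀ (sub_ne_zero.2 hw), one_smul]
  have h := ((hasDerivAt_inv hv.ne').smul hQd).congr_of_eventuallyEq hVQ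
  refine h.congr_deriv ?_
  change v⁻¹ • (V v * V v) + (-(v ^ 2)⁻¹) • v • V v = v⁻¹ • (V v ^ 2 - V v)
  rw [pow_two (V v)]
  match_scalars <;> field_simp

theorem hasDerivAt_pow (hR : IsResolventFamily R) {v : ℝ} (hv : 0 < v) (n : ℕ) :
    HasDerivAt (fun v : ℝ => R v.toNNReal ^ n)
      ((n * v⁻¹ : ℝ) • (R v.toNNReal ^ (n + 1) - R v.toNNReal ^ n)) v := by
  induction n with
  | zero => simpa using hasDerivAt_const v (1 : X →L[ℂ] X)
  | succ n ih =>
    have h := ih.mul (hR.hasDerivAt hv)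
    have e : (fun v : ℝ => R v.toNNReal ^ (n + 1)) =
        (fun v : ℝ => R v.toNNReal ^ n) * fun v : ℝ => R v.toNNReal := by
      ext1 v
      simp [pow_succ]
    rw [e]
    refine h.congr_deriv ?_
    rw [smul_mul_assoc, mul_smul_comm, sub_mul, mul_sub, ← pow_succ, ← pow_succ, ← pow_add,
      ← add_smul]
    push_cast
    ring_nf

theorem norm_pow_le (hR : IsResolventFamily R) : ∃ M : ℝ, 0 ≤ M ∧ ∀ s n, ‖R s ^ n‖ ≤ M ^ n := by
  obtain ⟨M, hM⟩ := hR.bounded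
  refine ⟨M, (norm_nonneg _).trans (hM 0), fun s n => ?_⟩
  induction n with
  | zero => simpa [ContinuousLinearMap.one_def] using ContinuousLinearMap.norm_id_le
  | succ n ih =>
    rw [pow_succ, pow_succ]
    refine (norm_mul_le _ _).trans ?_
    gcongr
    · exact pow_nonneg ((norm_nonneg _).trans (hM 0)) n
    · exact hM s

theorem norm_pow_apply_le (hR : IsResolventFamily R) (n : ℕ) (x : X) :
    ∃ C : ℝ, ∀ s, ‖(R s ^ n) x‖ ≤ C := by
  obtain ⟨M, -, hM⟩ := hR.norm_pow_le
  refine ⟨M ^ n * ‖x‖, fun s => ((R s ^ n).le_opNorm x).trans ?_⟩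
  gcongr
  exact hM s n

/-- Away from `0` differentiability gives norm continuity; at `0` only strong continuity is assumed.
-/
theorem continuous_apply (hR : IsResolventFamily R) (x : X) : Continuous fun s => R s x := by
  rw [continuous_iff_continuousAt]
  intro s
  rcases eq_or_ne s 0 with rfl | hs
  · simpa [ContinuousAt, hR.zero] using hR.tendsto_zero x
  · have hs' : (0 : ℝ) < s := by exact_mod_cast pos_iff_ne_zero.2 hs
    have h1 : ContinuousAt (fun v : ℝ => R v.toNNReal x) s :=
      (hR.hasDerivAt hs').continuousAt.clm_apply continuousAt_const
    have h2 : (fun s => R s x) = (fun v : ℝ => R v.toNNReal x) ∘ ((↑) : ℝ≥0 → ℝ) := by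
      ext1 t
      simp
    rw [h2]
    exact ContinuousAt.comp h1 NNReal.continuous_coe.continuousAt

theorem continuous_pow_apply (hR : IsResolventFamily R) (n : ℕ) (x : X) :
    Continuous fun s => (R s ^ n) x := by
  obtain ⟨M, hM0, hM⟩ := hR.norm_pow_le
  induction n generalizing x with
  | zero => simpa using continuous_const
  | succ n ih =>
    rw [continuous_iff_continuousAt]
    intro s
    rw [ContinuousAt, tendsto_iff_norm_sub_tendsto_zero]
    have hlim : Filter.Tendsto
        (fun t => M ^ n * ‖R t x - R s x‖ + ‖(R t ^ n) (R s x) - (R s ^ n) (R s x)‖)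
        (nhds s) (nhds 0) := by
      have : Continuous
          (fun t => M ^ n * ‖R t x - R s x‖ + ‖(R t ^ n) (R s x) - (R s ^ n) (R s x)‖) :=
        (continuous_const.mul ((hR.continuous_apply x).sub continuous_const).norm).add
          ((ih (R s x)).sub continuous_const).norm
      simpa using this.tendsto s
    refine squeeze_zero (fun _ => norm_nonneg _) (fun t => ?_) hlim
    have : (R t ^ (n + 1)) x - (R s ^ (n + 1)) x =
        (R t ^ n) (R t x - R s x) + ((R t ^ n) (R s x) - (R s ^ n) (R s x)) := by
      simp [pow_succ]
    rw [this]
    refine (norm_add_le _ _).trans ?_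
    gcongr
    exact ((R t ^ n).le_opNorm _).trans (by gcongr; exact hM t n)

theorem stronglyMeasurable_pow_apply (hR : IsResolventFamily R) (n : ℕ) (x : X) :
    StronglyMeasurable fun s => (R s ^ n) x :=
  (hR.continuous_pow_apply n x).stronglyMeasurable

theorem integrable_pow_apply (hR : IsResolventFamily R) (ν : ComplexMeasure ℝ≥0) (n : ℕ) (x : X) :
    ν.Integrable fun s => (R s ^ n) x := by
  obtain ⟨C, hC⟩ := hR.norm_pow_apply_le n x
  exact integrable_of_norm_le ν (hR.stronglyMeasurable_pow_apply n x) hC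

end IsResolventFamily

/-! ### Averages over segments -/

/-- The convex combination `u p + (1 - u) t`. -/
noncomputable def segmentPoint (p t : ℝ≥0) (u : unitInterval) : ℝ≥0 :=
  unitInterval.toNNReal u * p + unitInterval.toNNReal (unitInterval.symm u) * t

theorem coe_segmentPoint (p t : ℝ≥0) (u : unitInterval) :
    (segmentPoint p t u : ℝ) = u * p + (1 - u) * t := by
  simp [segmentPoint]

theorem continuous_segmentPoint :
    Continuous fun q : ℝ≥0 × ℝ≥0 × unitInterval => segmentPoint q.1 q.2.1 q.2.2 := by
  have h : Continuous unitInterval.toNNReal := Continuous.subtype_mk continuous_subtype_val _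
  unfold segmentPoint
  fun_prop

theorem segmentPoint_mul (p t : ℝ≥0) (u w : unitInterval) :
    segmentPoint (segmentPoint p t u) t w = segmentPoint p t (u * w) := by
  apply NNReal.coe_injective
  simp only [coe_segmentPoint, Set.Icc.coe_mul]
  ring

/-- The probability measure `n u ^ (n - 1) du` on `[0, 1]`. -/
noncomputable def powerMeasure (n : ℕ) : Measure unitInterval :=
  volume.withDensity fun u => ENNReal.ofReal (n * (u : ℝ) ^ (n - 1))

theorem measurable_powerDensity (n : ℕ) :
    Measurable fun u : unitInterval => ENNReal.ofReal (n * (u : ℝ) ^ (n - 1)) := by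
  fun_prop

instance (n : ℕ) : IsFiniteMeasure (powerMeasure n) := by
  refine isFiniteMeasure_withDensity ?_
  refine ((lintegral_mono (g := fun _ => ENNReal.ofReal n) fun u => ?_).trans_lt ?_).ne
  · exact ENNReal.ofReal_le_ofReal (mul_le_of_le_one_right n.cast_nonneg
      (pow_le_one₀ u.2.1 u.2.2))
  · simp

theorem integral_powerMeasure {E : Type*} [NormedAddCommGroup E] [NormedSpace ℝ E] (n : ℕ)
    (g : ℝ → E) :
    ∫ u : unitInterval, g u ∂powerMeasure n =
      ∫ u in (0 : ℝ)..1, (n * u ^ (n - 1)) • g u := by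
  rw [powerMeasure, integral_withDensity_eq_integral_toReal_smul (measurable_powerDensity n)
    (.of_forall fun _ => ENNReal.ofReal_lt_top)]
  have h : ∀ u : unitInterval, (ENNReal.ofReal (n * (u : ℝ) ^ (n - 1))).toReal • g u =
      (fun u : ℝ => (n * u ^ (n - 1)) • g u) u := fun u => by
    rw [ENNReal.toReal_ofReal (mul_nonneg n.cast_nonneg (pow_nonneg u.2.1 _))]
  simp_rw [h]
  rw [unitInterval.measurePreserving_coe.integral_comp
    (MeasurableEmbedding.subtype_coe measurableSet_Icc) (fun u : ℝ => (n * u ^ (n - 1)) • g u),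
    intervalIntegral.integral_of_le zero_le_one, unitInterval, integral_Icc_eq_integral_Ioc]

namespace IsResolventFamily

variable {X : Type*} [NormedAddCommGroup X] [NormedSpace ℂ X] {R : ℝ≥0 → X →L[ℂ] X}

/-- With `w = u p + (1 - u) t` one has `u (p - t) = w - t`. The product rule leaves terms in `R w ^
(n + 2) R t` and `R w ^ (n + 1) R t`, which the resolvent identity for `w` and `t` merges into `R w
^ (n + 2)`. -/
theorem hasDerivAt_segment (hR : IsResolventFamily R) (n : ℕ) (p t : ℝ≥0) (x : X) {u : ℝ}
    (hu : 0 < u * p + (1 - u) * t) :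
    HasDerivAt
      (fun u : ℝ => u ^ (n + 1) • (R (u * p + (1 - u) * t).toNNReal ^ (n + 1)) (R t x))
      (((n + 1 : ℕ) * u ^ n) • (R (u * p + (1 - u) * t).toNNReal ^ (n + 2)) x) u := by
  set w : ℝ := u * p + (1 - u) * t with hw
  have hd : HasDerivAt (fun u : ℝ => u * (p : ℝ) + (1 - u) * t) (p - t : ℝ) u := by
    have := ((hasDerivAt_id u).mul_const (p : ℝ)).add
      (((hasDerivAt_id u).const_sub 1).mul_const (t : ℝ))
    refine this.congr_deriv ?_
    ring
  have h1 := (hR.hasDerivAt_pow hu (n + 1)).scomp u hd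
  have h2 := ((ContinuousLinearMap.apply ℂ X (R t x)).restrictScalars ℝ).hasFDerivAt.comp_hasDerivAt
    u h1
  have h3 := (_root_.hasDerivAt_pow (n + 1) u).smul h2
  refine h3.congr_deriv ?_
  have key : w • (R w.toNNReal ^ (n + 2)) x - (t : ℝ) • (R w.toNNReal ^ (n + 1)) (R t x) =
      (u * (p - t)) • (R w.toNNReal ^ (n + 2)) (R t x) := by
    have h := congrArg (fun T => (R w.toNNReal ^ (n + 1)) (T x)) (hR.identity t w.toNNReal)
    rw [(hR.commute t w.toNNReal).eq] at h
    have e : u * (p - t) = w - t := by rw [hw]; ring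
    rw [e, pow_succ _ (n + 1)]
    generalize R w.toNNReal ^ (n + 1) = T at h ⊢
    simpa [← Complex.coe_smul, Real.coe_toNNReal _ hu.le] using h
  have hw0 : w ≠ 0 := hu.ne'
  have e1 : (R w.toNNReal ^ (n + 2)) x = w⁻¹ • ((t : ℝ) • (R w.toNNReal ^ (n + 1)) (R t x) +
      (u * (p - t)) • (R w.toNNReal ^ (n + 2)) (R t x)) := by
    rw [← key, add_sub_cancel, smul_smul, inv_mul_cancel₀ hw0, one_smul]
  rw [e1]
  change u ^ (n + 1) • (((p - t : ℝ) • ((n + 1 : ℕ) * w⁻¹) • (R w.toNNReal ^ (n + 2) -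
    R w.toNNReal ^ (n + 1))) (R t x)) +
    (((n + 1 : ℕ) : ℝ) * u ^ n) • (R w.toNNReal ^ (n + 1)) (R t x) = _
  simp only [smul_apply, sub_apply]
  match_scalars
  · field_simp
    ring
  · field_simp
    rw [hw]
    ring

/-- Fundamental theorem of calculus for `hasDerivAt_segment`: the boundary term at `u = 1` is the
left side, and the one at `u = 0` vanishes because `1 ≤ n`. -/
theorem pow_mul_apply_eq_integral [CompleteSpace X] (hR : IsResolventFamily R) {n : ℕ}
    (hn : 1 ≤ n) (p t : ℝ≥0) (x : X) :
    (R p ^ n) (R t x) =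
      ∫ u, (R (segmentPoint p t u) ^ (n + 1)) x ∂powerMeasure n := by
  obtain ⟨n, rfl⟩ := Nat.exists_eq_add_of_le' hn
  have hg : ∀ u : unitInterval, (R (segmentPoint p t u) ^ (n + 2)) x =
      (fun u : ℝ => (R (u * p + (1 - u) * t).toNNReal ^ (n + 2)) x) u := fun u => by
    simp only [← coe_segmentPoint, Real.toNNReal_coe]
  have hcont (k : ℕ) (y : X) :
      Continuous fun u : ℝ => (R (u * p + (1 - u) * t).toNNReal ^ k) y :=
    (hR.continuous_pow_apply k y).comp (by fun_prop)
  simp_rw [add_assoc, one_add_one_eq_two, hg]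
  rw [integral_powerMeasure (n + 1)
    (fun u : ℝ => (R (u * p + (1 - u) * t).toNNReal ^ (n + 2)) x), Nat.add_sub_cancel]
  -- The derivative formula needs a positive point. Unless both ends are `0`, every interior point
  -- of the segment is positive, and continuity suffices at the ends.
  by_cases h0 : p = 0 ∧ t = 0
  · obtain ⟨rfl, rfl⟩ := h0
    have : (n + 1 : ℝ) ≠ 0 := by positivity
    simp [hR.zero, intervalIntegral.integral_smul_const, this]
  · have hpos : ∀ u ∈ Set.Ioo (0 : ℝ) 1, 0 < u * p + (1 - u) * t := by
      rintro u ⟨hu0, hu1⟩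
      have hp : 0 ≤ u * p := by positivity
      have ht : 0 ≤ (1 - u) * t := mul_nonneg (by linarith) t.2
      rcases not_and_or.1 h0 with h | h
      · have : 0 < u * p := mul_pos hu0 (by exact_mod_cast pos_iff_ne_zero.2 h)
        linarith
      · have : 0 < (1 - u) * t := mul_pos (by linarith) (by exact_mod_cast pos_iff_ne_zero.2 h)
        linarith
    rw [intervalIntegral.integral_eq_sub_of_hasDerivAt_of_le zero_le_one
      (f := fun u : ℝ => u ^ (n + 1) • (R (u * p + (1 - u) * t).toNNReal ^ (n + 1)) (R t x))
      ((continuous_pow _).smul (hcont _ _)).continuousOn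
      (fun u hu => hR.hasDerivAt_segment n p t x (hpos u hu))
      (((continuous_const.mul (continuous_pow _)).smul (hcont _ _)).intervalIntegrable _ _)]
    simp

end IsResolventFamily

/-- The measure on `[0, 1]` through which `R p ^ n * R t ^ m` is an average of `R s ^ (n + m)` over
the segment from `t` to `p` (a beta distribution). -/
noncomputable def segmentMeasure (n : ℕ) : ℕ → Measure unitInterval
  | 0 => Measure.dirac 1
  | m + 1 => ((segmentMeasure n m).prod (powerMeasure (n + m))).map fun q => q.1 * q.2

instance (n m : ℕ) : IsFiniteMeasure (segmentMeasure n m) := by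
  induction m with
  | zero => unfold segmentMeasure; infer_instance
  | succ m ih => unfold segmentMeasure; infer_instance

/-- The complex measure `σ` such that products of averages of order `n` and `m` with respect to `ν`
and `ν'` are averages of order `n + m` with respect to `σ`. -/
noncomputable def mulMeasure (n : ℕ) (ν : ComplexMeasure ℝ≥0) (m : ℕ) (ν' : ComplexMeasure ℝ≥0) :
    ComplexMeasure ℝ≥0 :=
  (((dominating ν).prod ((dominating ν').prod (segmentMeasure n m))).withDensityᵥ
    fun q => density ν q.1 * density ν' q.2.1).map
      fun q : ℝ≥0 × ℝ≥0 × unitInterval => segmentPoint q.1 q.2.1 q.2.2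

theorem integrable_mul_density (n : ℕ) (ν : ComplexMeasure ℝ≥0) (m : ℕ) (ν' : ComplexMeasure ℝ≥0) :
    Integrable (fun q : ℝ≥0 × ℝ≥0 × unitInterval => density ν q.1 * density ν' q.2.1)
      ((dominating ν).prod ((dominating ν').prod (segmentMeasure n m))) :=
  (integrable_density ν).mul_prod ((integrable_density ν').comp_fst (segmentMeasure n m))

namespace IsResolventFamily

variable {X : Type*} [NormedAddCommGroup X] [NormedSpace ℂ X] [CompleteSpace X]
  {R : ℝ≥0 → X →L[ℂ] X}

/-- Induction on `m`: the hypothesis is applied to `R t x`, then the last factor is absorbed by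
averaging from each point of the segment towards `t`. This stays on the segment and multiplies
parameters (`segmentPoint_mul`). -/
theorem pow_mul_pow_apply_eq_integral (hR : IsResolventFamily R) {n : ℕ} (hn : 1 ≤ n) (m : ℕ)
    (p t : ℝ≥0) (x : X) :
    (R p ^ n) ((R t ^ m) x) =
      ∫ u, (R (segmentPoint p t u) ^ (n + m)) x ∂segmentMeasure n m := by
  induction m generalizing x with
  | zero => simp [segmentMeasure, segmentPoint]
  | succ m ih =>
    obtain ⟨C, hC⟩ := hR.norm_pow_apply_le (n + (m + 1)) x
    have hc : Continuous fun u => segmentPoint p t u :=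
      continuous_segmentPoint.comp (by fun_prop : Continuous fun u => (p, t, u))
    have hcont : Continuous fun u => (R (segmentPoint p t u) ^ (n + (m + 1))) x :=
      (hR.continuous_pow_apply (n + (m + 1)) x).comp hc
    have hmul : Continuous fun q : unitInterval × unitInterval => q.1 * q.2 := by fun_prop
    have hcm : Continuous fun q : unitInterval × unitInterval =>
        (R (segmentPoint p t (q.1 * q.2)) ^ (n + (m + 1))) x := hcont.comp hmul
    rw [pow_succ, mul_apply_eq_comp, ih, segmentMeasure,
      integral_map hmul.measurable.aemeasurable hcont.aestronglyMeasurable,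
      integral_prod _ (Integrable.of_bound hcm.aestronglyMeasurable C
        (.of_forall fun _ => hC _))]
    refine integral_congr_ae (.of_forall fun u => ?_)
    simp only
    rw [hR.pow_mul_apply_eq_integral (by omega)]
    simp only [segmentPoint_mul, add_assoc]

/-- The operator `x ↦ ∫ R s ^ n x ν(ds)`. -/
noncomputable def transform (hR : IsResolventFamily R) (n : ℕ) (ν : ComplexMeasure ℝ≥0) :
    X →L[ℂ] X :=
  LinearMap.mkContinuousOfExistsBound
    { toFun := fun x => cintegral ν fun s => (R s ^ n) x
      map_add' := fun x y => by
        simp only [map_add]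
        exact VectorMeasure.integral_fun_add (hR.integrable_pow_apply ν n x)
          (hR.integrable_pow_apply ν n y)
      map_smul' := fun c x => by
        rw [cintegral_eq_integral_density _ (hR.integrable_pow_apply ν n _),
          cintegral_eq_integral_density _ (hR.integrable_pow_apply ν n _), RingHom.id_apply,
          ← integral_smul]
        simp only [map_smul, smul_comm c] } <| by
    obtain ⟨M, hM0, hM⟩ := hR.norm_pow_le
    refine ⟨M ^ n * ‖(ContinuousLinearMap.lsmul ℝ ℂ (E := X)).flip‖ * ν.variation.real Set.univ,
      fun x => ?_⟩
    refine (VectorMeasure.norm_integral_le_of_norm_le_const (C := M ^ n * ‖x‖)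
      (.of_forall fun s => ?_)).trans (le_of_eq (by ring))
    exact ((R s ^ n).le_opNorm x).trans (by gcongr; exact hM s n)

theorem transform_apply (hR : IsResolventFamily R) (n : ℕ) (ν : ComplexMeasure ℝ≥0) (x : X) :
    hR.transform n ν x = cintegral ν fun s => (R s ^ n) x :=
  rfl

theorem transform_apply_eq_integral (hR : IsResolventFamily R) (n : ℕ) (ν : ComplexMeasure ℝ≥0)
    (x : X) :
    hR.transform n ν x = ∫ s, density ν s • (R s ^ n) x ∂dominating ν :=
  cintegral_eq_integral_density ν (hR.integrable_pow_apply ν n x)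

theorem transform_add (hR : IsResolventFamily R) (n : ℕ) (ν ν' : ComplexMeasure ℝ≥0) :
    hR.transform n (ν + ν') = hR.transform n ν + hR.transform n ν' := by
  ext x
  exact cintegral_add (hR.integrable_pow_apply ν n x) (hR.integrable_pow_apply ν' n x)

theorem transform_smul (hR : IsResolventFamily R) (n : ℕ) (c : ℂ) (ν : ComplexMeasure ℝ≥0) :
    hR.transform n (c • ν) = c • hR.transform n ν := by
  ext x
  obtain ⟨C, hC⟩ := hR.norm_pow_apply_le n x
  exact cintegral_smul c ν (hR.stronglyMeasurable_pow_apply n x) hC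

theorem transform_dirac (hR : IsResolventFamily R) (n : ℕ) :
    hR.transform n (VectorMeasure.dirac 0 1) = 1 := by
  ext x
  rw [transform_apply, cintegral_dirac, hR.zero, one_pow]

/-- Fubini together with `pow_mul_pow_apply_eq_integral`. The same measure serves every resolvent
family. -/
theorem transform_mulMeasure (hR : IsResolventFamily R) {n : ℕ} (hn : 1 ≤ n) (m : ℕ)
    (ν ν' : ComplexMeasure ℝ≥0) :
    hR.transform (n + m) (mulMeasure n ν m ν') = hR.transform n ν * hR.transform m ν' := by
  ext x
  obtain ⟨C, hC⟩ := hR.norm_pow_apply_le (n + m) x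
  have hi := integrable_mul_density n ν m ν'
  have hcont := (hR.continuous_pow_apply (n + m) x).comp continuous_segmentPoint
  have hint : Integrable (fun q : ℝ≥0 × ℝ≥0 × unitInterval =>
      (density ν q.1 * density ν' q.2.1) • (R (segmentPoint q.1 q.2.1 q.2.2) ^ (n + m)) x)
      ((dominating ν).prod ((dominating ν').prod (segmentMeasure n m))) :=
    hi.smul_bdd C hcont.aestronglyMeasurable (.of_forall fun _ => hC _)
  rw [transform_apply, mulMeasure, cintegral_map_withDensity hi continuous_segmentPoint.measurable
    (hR.stronglyMeasurable_pow_apply _ x) hC, integral_prod _ hint, mul_apply_eq_comp,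
    hR.transform_apply_eq_integral n ν]
  refine integral_congr_ae ?_
  filter_upwards [hint.prod_right_ae] with s hs
  rw [integral_prod _ hs, hR.transform_apply_eq_integral m ν',
    ← ContinuousLinearMap.integral_comp_comm _
      (integrable_density_smul ν' (hR.integrable_pow_apply ν' m x)), ← integral_smul]
  refine integral_congr_ae (.of_forall fun t => ?_)
  simp only [map_smul]
  rw [hR.pow_mul_pow_apply_eq_integral hn, integral_smul, smul_smul]

end IsResolventFamily

/-! ### Uniqueness of the representing measure -/

section Uniqueness

variable {μ : Measure ℝ≥0} {h : ℝ≥0 → ℂ}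

theorem inv_one_add_mul_nonneg {z : ℝ} (hz : 0 < z) (s : ℝ≥0) : 0 ≤ (1 + z * s)⁻¹ := by
  positivity

theorem inv_one_add_mul_le_one {z : ℝ} (hz : 0 < z) (s : ℝ≥0) : (1 + z * s)⁻¹ ≤ 1 :=
  inv_le_one_of_one_le₀ (le_add_of_nonneg_right (by positivity))

theorem integrable_stieltjesKernel_smul (hh : Integrable h μ) {z : ℝ} (hz : 0 < z) (m : ℕ) :
    Integrable (fun s : ℝ≥0 => ((1 + z * s)⁻¹ ^ m : ℝ) • h s) μ := by
  have hm : Measurable fun s : ℝ≥0 => ((1 + z * s)⁻¹ ^ m : ℝ) := by fun_prop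
  refine hh.bdd_smul 1 hm.aestronglyMeasurable (.of_forall fun s => ?_)
  rw [Real.norm_of_nonneg (pow_nonneg (inv_one_add_mul_nonneg hz s) _)]
  exact pow_le_one₀ (inv_one_add_mul_nonneg hz s) (inv_one_add_mul_le_one hz s)

/-- For `y = (1 + zs)⁻¹` one has `y ^ (m + 1) = y ^ m + (z / m) ∂(y ^ m)/∂z`, and both terms on the
right integrate to zero. -/
theorem integral_stieltjesKernel_succ_eq_zero (hh : Integrable h μ) {m : ℕ} (hm : 1 ≤ m)
    (H : ∀ z : ℝ, 0 < z → ∫ s : ℝ≥0, ((1 + z * s)⁻¹ ^ m : ℝ) • h s ∂μ = 0) {z : ℝ} (hz : 0 < z) :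
    ∫ s : ℝ≥0, ((1 + z * s)⁻¹ ^ (m + 1) : ℝ) • h s ∂μ = 0 := by
  set c : ℝ → ℝ≥0 → ℝ := fun z s => -(m * s * (1 + z * s)⁻¹ ^ (m + 1)) with hc
  have hcm : Measurable (c z) := by fun_prop
  have hpos : ∀ᶠ w in nhds z, 0 < w := lt_mem_nhds hz
  -- For `w > z / 2` the bound `s / (1 + ws) ≤ 2 / z` dominates the derivative uniformly in `s`.
  have hderiv := hasDerivAt_integral_of_dominated_loc_of_deriv_le (μ := μ) (𝕜 := ℝ) (x₀ := z)
    (s := Set.Ioi (z / 2)) (bound := fun s => (m * (2 / z)) * ‖h s‖)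
    (F := fun (z : ℝ) s => ((1 + z * s)⁻¹ ^ m : ℝ) • h s) (F' := fun z s => c z s • h s)
    (Ioi_mem_nhds (by linarith))
    (hpos.mono fun w hw => (integrable_stieltjesKernel_smul hh hw m).aestronglyMeasurable)
    (integrable_stieltjesKernel_smul hh hz m)
    (hcm.aestronglyMeasurable.smul hh.aestronglyMeasurable)
    (.of_forall fun s w hw => ?_) (hh.norm.const_mul _) (.of_forall fun s w hw => ?_)
  · have h0 : HasDerivAt (fun z : ℝ => ∫ s : ℝ≥0, ((1 + z * s)⁻¹ ^ m : ℝ) • h s ∂μ) 0 z :=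
      (hasDerivAt_const z (0 : ℂ)).congr_of_eventuallyEq (hpos.mono fun w hw => H w hw)
    have hzero := hderiv.2.unique h0
    have e : ∀ s : ℝ≥0, ((1 + z * s)⁻¹ ^ (m + 1) : ℝ) • h s =
        ((1 + z * s)⁻¹ ^ m : ℝ) • h s + (z / m) • c z s • h s := by
      intro s
      rw [smul_smul, ← add_smul]
      congr 1
      have h1 : (m : ℝ) ≠ 0 := by exact_mod_cast (by omega : m ≠ 0)
      have h2 : (1 + z * s) * (1 + z * s)⁻¹ = 1 := mul_inv_cancel₀ (by positivity)
      simp only [hc]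
      generalize (1 + z * s)⁻¹ = y at *
      field_simp
      linear_combination (y ^ m) * h2
    simp_rw [e]
    rw [integral_add (integrable_stieltjesKernel_smul hh hz m) 
      (g := fun s => (z / m) • c z s • h s) (hderiv.1.smul (z / m : ℝ)), integral_smul, hzero, H z hz]
    simp
  · have hw0 : 0 < w := lt_trans (by positivity) (Set.mem_Ioi.1 hw)
    have h1 := inv_one_add_mul_nonneg hw0 s
    have h2 := inv_one_add_mul_le_one hw0 s
    rw [norm_smul]
    gcongr
    rw [Real.norm_eq_abs, abs_neg, abs_of_nonneg (by positivity), mul_assoc]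
    gcongr
    have h3 : (s : ℝ) * (1 + w * s)⁻¹ ≤ 2 / z := by
      rw [← div_eq_mul_inv, div_le_div_iff₀ (by positivity) hz]
      have : z ≤ 2 * w := by linarith [Set.mem_Ioi.1 hw]
      nlinarith [s.2, mul_le_mul_of_nonneg_left this s.2]
    calc (s : ℝ) * (1 + w * s)⁻¹ ^ (m + 1) = (s * (1 + w * s)⁻¹) * (1 + w * s)⁻¹ ^ m := by ring
      _ ≤ 2 / z * 1 := by
        gcongr
        exact pow_le_one₀ h1 h2
      _ = 2 / z := mul_one _
  · have hw0 : 0 < w := lt_trans (by positivity) (Set.mem_Ioi.1 hw)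
    refine HasDerivAt.smul_const ?_ _
    have hne : 1 + w * (s : ℝ) ≠ 0 := by positivity
    have hd := ((((hasDerivAt_id w).mul_const (s : ℝ)).const_add 1).inv hne).pow m
    refine hd.congr_deriv ?_
    obtain ⟨k, rfl⟩ := Nat.exists_eq_add_of_le' hm
    simp only [hc, Pi.inv_apply, id, Nat.add_sub_cancel, inv_pow]
    field_simp
    ring

/-- Vanishing moments kill polynomials in `v`; Weierstrass approximation on `[0, 1]` passes to
continuous functions. -/
theorem integral_continuous_smul_eq_zero {v : ℝ≥0 → ℝ} (hv : Measurable v)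
    (hv1 : ∀ s, v s ∈ Set.Icc (0 : ℝ) 1) {g : ℝ≥0 → ℂ} (hg : Integrable g μ)
    (H : ∀ k : ℕ, ∫ s, (v s ^ k) • g s ∂μ = 0) {φ : ℝ → ℝ} (hφ : Continuous φ) :
    ∫ s, φ (v s) • g s ∂μ = 0 := by
  have hint (p : ℝ → ℝ) (hp : Continuous p) : Integrable (fun s => p (v s) • g s) μ := by
    obtain ⟨C, hC⟩ := isCompact_Icc.exists_bound_of_continuousOn (hp.continuousOn (s := Set.Icc 0 1))
    exact hg.bdd_smul C (hp.measurable.comp hv).aestronglyMeasurable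
      (.of_forall fun s => hC _ (hv1 s))
  have hpoly (p : Polynomial ℝ) : ∫ s, p.eval (v s) • g s ∂μ = 0 := by
    simp_rw [Polynomial.eval_eq_sum_range, Finset.sum_smul]
    rw [integral_finsetSum _ fun k _ => hint (fun x => p.coeff k * x ^ k) (by fun_prop)]
    refine Finset.sum_eq_zero fun k _ => ?_
    simp_rw [← smul_smul]
    rw [integral_smul, H, smul_zero]
  rw [← norm_le_zero_iff]
  refine le_of_forall_pos_le_add fun ε hε => ?_
  set I := ∫ s, ‖g s‖ ∂μ with hI
  have hI0 : 0 ≤ I := integral_nonneg fun _ => norm_nonneg _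
  obtain ⟨p, hp⟩ := exists_polynomial_near_of_continuousOn 0 1 φ hφ.continuousOn (ε / (I + 1))
    (by positivity)
  rw [← sub_zero (∫ s, φ (v s) • g s ∂μ), ← hpoly p,
    ← integral_sub (hint φ hφ) (hint _ p.continuous)]
  calc _ ≤ ∫ s, ‖φ (v s) • g s - p.eval (v s) • g s‖ ∂μ := norm_integral_le_integral_norm _
    _ ≤ ∫ s, ε / (I + 1) * ‖g s‖ ∂μ := by
      refine integral_mono_of_nonneg (.of_forall fun _ => norm_nonneg _) (hg.norm.const_mul _)
        (.of_forall fun s => ?_)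
      simp only
      rw [← sub_smul, norm_smul, Real.norm_eq_abs, abs_sub_comm]
      gcongr
      exact (hp _ (hv1 s)).le
    _ = ε / (I + 1) * I := integral_const_mul _ _
    _ ≤ 0 + ε := by
      rw [zero_add, div_mul_eq_mul_div, div_le_iff₀ (by positivity)]
      nlinarith

theorem setIntegral_Iic_eq_zero {v : ℝ≥0 → ℝ} (hv : StrictAnti v) (hvm : Measurable v)
    (hv1 : ∀ s, v s ∈ Set.Icc (0 : ℝ) 1) {g : ℝ≥0 → ℂ} (hg : Integrable g μ)
    (H : ∀ k : ℕ, ∫ s, (v s ^ k) • g s ∂μ = 0) (a : ℝ≥0) :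
    ∫ s in Set.Iic a, g s ∂μ = 0 := by
  -- Since `v` is strictly decreasing, `s ≤ a` means `v s ≥ v a`. These cutoffs equal `1` there and
  -- fall linearly to `0` with slope `k` below `v a`, so they converge pointwise to the indicator of
  -- `[0, a]`.
  set φ : ℕ → ℝ → ℝ := fun k x => max 0 (1 - k * max 0 (v a - x)) with hφ
  have hφc (k : ℕ) : Continuous (φ k) := by fun_prop
  have hlim : Filter.Tendsto (fun k => ∫ s, φ k (v s) • g s ∂μ) Filter.atTop
      (nhds (∫ s, (Set.Iic a).indicator g s ∂μ)) := by
    refine tendsto_integral_of_dominated_convergence (fun s => ‖g s‖)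
      (fun k => ((hφc k).measurable.comp hvm).aestronglyMeasurable.smul hg.aestronglyMeasurable)
      hg.norm (fun k => .of_forall fun s => ?_) (.of_forall fun s => ?_)
    · rw [norm_smul]
      refine mul_le_of_le_one_left (norm_nonneg _) ?_
      rw [Real.norm_of_nonneg (le_max_left _ _)]
      refine max_le zero_le_one (sub_le_self _ (by positivity))
    · by_cases hs : s ≤ a
      · have : ∀ k, φ k (v s) = 1 := fun k => by
          simp [hφ, max_eq_left (sub_nonpos.2 (hv.antitone hs))]
        simp [hs, this]
      · have hlt : 0 < v a - v s := sub_pos.2 (hv (not_le.1 hs))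
        obtain ⟨N, hN⟩ := exists_nat_gt (v a - v s)⁻¹
        refine tendsto_const_nhds.congr' ?_
        filter_upwards [Filter.eventually_ge_atTop N] with k hk
        have hk' : (v a - v s)⁻¹ < k := hN.trans_le (by exact_mod_cast hk)
        have : 1 < k * (v a - v s) := (inv_lt_iff_one_lt_mul₀ hlt).1 hk'
        have e : φ k (v s) = 0 := by
          simp only [hφ]
          rw [max_eq_right hlt.le, max_eq_left (by linarith)]
        simp [hs, e]
  rw [← integral_indicator measurableSet_Iic]
  refine tendsto_nhds_unique hlim ?_
  simp_rw [fun k => integral_continuous_smul_eq_zero hvm hv1 hg H (hφc k)]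
  exact tendsto_const_nhds

/-- A complex measure whose generalized Stieltjes transform of some order vanishes is zero. -/
theorem eq_zero_of_represents_zero {n : ℕ} (hn : 1 ≤ n) {ν : ComplexMeasure ℝ≥0}
    (H : Represents n ν 0) : ν = 0 := by
  have hh := integrable_density ν
  have H1 : ∀ m, n ≤ m → ∀ z : ℝ, 0 < z →
      ∫ s : ℝ≥0, ((1 + z * s)⁻¹ ^ m : ℝ) • density ν s ∂dominating ν = 0 := by
    intro m hm
    induction m, hm using Nat.le_induction with
    | base =>
      intro z hz
      have h := H ⟨z, hz⟩
      have e : (fun s : ℝ≥0 => 1 / (1 + (z : ℂ) * ((s : ℝ) : ℂ)) ^ n) =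
          fun s : ℝ≥0 => (((1 + z * s)⁻¹ ^ n : ℝ) : ℂ) := by
        ext s
        push_cast
        rw [one_div, inv_pow]
      simp only [e, Pi.zero_apply] at h
      rw [h, cintegral_eq_integral_density]
      · refine integral_congr_ae (.of_forall fun s => ?_)
        simp [mul_comm]
      · refine integrable_of_norm_le ν (C := 1) (Measurable.stronglyMeasurable (by fun_prop))
          fun s => ?_
        rw [Complex.norm_real, Real.norm_of_nonneg (pow_nonneg (inv_one_add_mul_nonneg hz s) _)]
        exact pow_le_one₀ (inv_one_add_mul_nonneg hz s) (inv_one_add_mul_le_one hz s)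
    | succ m hm ih =>
      intro z hz
      exact integral_stieltjesKernel_succ_eq_zero hh (hn.trans hm) ih hz
  -- Now only `z = 1` is used: the orders `k + n` are the moments in `v` of the density `v ^ n •
  -- density ν`. The factor `1 *` keeps the form of the general kernel.
  set v : ℝ≥0 → ℝ := fun s => (1 + 1 * (s : ℝ))⁻¹ with hv
  have hvm : Measurable v := by fun_prop
  have hv1 : ∀ s, v s ∈ Set.Icc (0 : ℝ) 1 := fun s =>
    ⟨inv_one_add_mul_nonneg one_pos s, inv_one_add_mul_le_one one_pos s⟩
  have hva : StrictAnti v := fun s t hst => by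
    simp only [hv]
    gcongr
  have hg : Integrable (fun s => v s ^ n • density ν s) (dominating ν) :=
    integrable_stieltjesKernel_smul hh one_pos n
  have H2 : ∀ k : ℕ, ∫ s, v s ^ k • v s ^ n • density ν s ∂dominating ν = 0 := fun k => by
    simp_rw [smul_smul, ← pow_add]
    exact H1 (k + n) (Nat.le_add_left _ _) 1 one_pos
  have hzero : (dominating ν).withDensityᵥ (fun s => v s ^ n • density ν s) =
      (dominating ν).withDensityᵥ 0 := by
    rw [withDensityᵥ_zero]
    refine VectorMeasure.ext_of_generateFrom (Set.range Set.Iic) ?_ ?_ isPiSystem_Iic ?_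
    · rintro _ ⟨a, rfl⟩
      rw [withDensityᵥ_apply hg measurableSet_Iic, setIntegral_Iic_eq_zero hva hvm hv1 hg H2]
      simp
    · rw [← borel_eq_generateFrom_Iic]
      exact BorelSpace.measurable_eq
    · rw [withDensityᵥ_apply hg MeasurableSet.univ, setIntegral_univ]
      simpa using H2 0
  have hae := hg.ae_eq_of_withDensityᵥ_eq (integrable_zero _ _ _) hzero
  rw [← withDensity_density ν, ← withDensityᵥ_zero (μ := dominating ν)]
  refine WithDensityᵥEq.congr_ae (hae.mono fun s hs => ?_)
  have : v s ^ n ≠ 0 := pow_ne_zero _ (by simp only [hv]; positivity)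
  exact (smul_eq_zero.1 hs).resolve_left this

end Uniqueness

/-! ### The scalar resolvent family -/

/-- Multiplication by `(1 + z s)⁻¹` on `ℂ`. -/
noncomputable def scalarFamily (z : ℝ) (s : ℝ≥0) : ℂ →L[ℂ] ℂ :=
  (1 / (1 + (z : ℂ) * ((s : ℝ) : ℂ))) • 1

theorem one_add_mul_ne_zero {z : ℝ} (hz : 0 < z) (s : ℝ≥0) :
    1 + (z : ℂ) * ((s : ℝ) : ℂ) ≠ 0 := by
  have : (0 : ℝ) < 1 + z * s := by positivity
  exact_mod_cast this.ne'

theorem isResolventFamily_scalarFamily {z : ℝ} (hz : 0 < z) :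
    IsResolventFamily (scalarFamily z) where
  zero := by simp [scalarFamily]
  identity s t := by
    have hs := mul_inv_cancel₀ (one_add_mul_ne_zero hz s)
    have ht := mul_inv_cancel₀ (one_add_mul_ne_zero hz t)
    simp only [scalarFamily, one_div, smul_mul_smul_comm, one_mul, smul_smul, ← sub_smul]
    congr 1
    linear_combination (-(t : ℂ) * (1 + (z : ℂ) * ((t : ℝ) : ℂ))⁻¹) * hs +
      (s : ℂ) * (1 + (z : ℂ) * ((s : ℝ) : ℂ))⁻¹ * ht
  bounded := by
    refine ⟨1, fun s => ContinuousLinearMap.opNorm_le_bound _ zero_le_one fun x => ?_⟩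
    have h : (1 / (1 + (z : ℂ) * ((s : ℝ) : ℂ))) = (((1 + z * s)⁻¹ : ℝ) : ℂ) := by
      push_cast
      rw [one_div]
    rw [scalarFamily, h, smul_apply, norm_smul, Complex.norm_real,
      Real.norm_of_nonneg (inv_one_add_mul_nonneg hz s)]
    exact mul_le_mul_of_nonneg_right (inv_one_add_mul_le_one hz s) (norm_nonneg _)
  tendsto_zero x := by
    have h : Continuous fun s : ℝ≥0 => scalarFamily z s x := by
      simp only [scalarFamily, smul_apply]
      refine Continuous.smul (continuous_const.div (by fun_prop) (one_add_mul_ne_zero hz))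
        continuous_const
    simpa [scalarFamily] using h.tendsto 0

theorem scalarFamily_pow_apply_one (z : ℝ) (n : ℕ) (s : ℝ≥0) :
    (scalarFamily z s ^ n) 1 = 1 / (1 + (z : ℂ) * ((s : ℝ) : ℂ)) ^ n := by
  simp [scalarFamily, smul_pow]

/-- This transfers results on resolvent families to the functions themselves. -/
theorem represents_iff {n : ℕ} {ν : ComplexMeasure ℝ≥0} {f : Set.Ioi (0 : ℝ) → ℂ} :
    Represents n ν f ↔
      ∀ z : Set.Ioi (0 : ℝ), f z = (isResolventFamily_scalarFamily z.2).transform n ν 1 := by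
  simp only [IsResolventFamily.transform_apply, scalarFamily_pow_apply_one, Represents]

/-! ### Algebra and uniqueness of representations -/

section Represents

variable {n m : ℕ} {ν ν' : ComplexMeasure ℝ≥0} {f g : Set.Ioi (0 : ℝ) → ℂ}

theorem Represents.add (hf : Represents n ν f) (hg : Represents n ν' g) :
    Represents n (ν + ν') (f + g) := by
  rw [represents_iff] at *
  intro z
  rw [IsResolventFamily.transform_add, Pi.add_apply, hf, hg, add_apply]

theorem Represents.smul (c : ℂ) (hf : Represents n ν f) : Represents n (c • ν) (c • f) := by
  rw [represents_iff] at *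
  intro z
  rw [IsResolventFamily.transform_smul, Pi.smul_apply, hf, smul_apply]

theorem represents_one (n : ℕ) : Represents n (VectorMeasure.dirac 0 1) 1 := by
  rw [represents_iff]
  intro z
  rw [IsResolventFamily.transform_dirac]
  rfl

theorem Represents.mul (hn : 1 ≤ n) (hf : Represents n ν f) (hg : Represents m ν' g) :
    Represents (n + m) (mulMeasure n ν m ν') (f * g) := by
  rw [represents_iff] at *
  intro z
  have h (S : ℂ →L[ℂ] ℂ) (c : ℂ) : S 1 * c = S c := by
    rw [mul_comm, ← smul_eq_mul, ← map_smul, smul_eq_mul, mul_one]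
  rw [IsResolventFamily.transform_mulMeasure _ hn, Pi.mul_apply, hf, hg, mul_apply_eq_comp, h]

/-- Raising the order of a representation on the left. -/
theorem Represents.raise (hn : 1 ≤ n) (m : ℕ) (hf : Represents n ν f) :
    Represents (n + m) (mulMeasure n ν m (VectorMeasure.dirac 0 1)) f := by
  simpa using hf.mul hn (represents_one m)

theorem Represents.raise' (hm : 1 ≤ m) (n : ℕ) (hf : Represents n ν f) :
    Represents (m + n) (mulMeasure m (VectorMeasure.dirac 0 1) n ν) f := by
  simpa using (represents_one m).mul hm hf

theorem Represents.measure_unique (hn : 1 ≤ n) (h : Represents n ν f) (h' : Represents n ν' f) :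
    ν = ν' := by
  have h0 := h.add (h'.smul (-1))
  have e : (-1 : ℂ) • ν' = -ν' := neg_one_smul ℂ ν'
  rw [e, neg_one_smul, add_neg_cancel, ← sub_eq_add_neg] at h0
  exact sub_eq_zero.1 (eq_zero_of_represents_zero hn h0)

end Represents

theorem mul_mem_boundedStieltjes {f g : Set.Ioi (0 : ℝ) → ℂ} (hf : f ∈ boundedStieltjes)
    (hg : g ∈ boundedStieltjes) : f * g ∈ boundedStieltjes := by
  obtain ⟨n, hn, ν, hν⟩ := hf
  obtain ⟨m, hm, ν', hν'⟩ := hg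
  exact ⟨n + m, by omega, _, hν.mul hn hν'⟩

theorem add_mem_boundedStieltjes {f g : Set.Ioi (0 : ℝ) → ℂ} (hf : f ∈ boundedStieltjes)
    (hg : g ∈ boundedStieltjes) : f + g ∈ boundedStieltjes := by
  obtain ⟨n, hn, ν, hν⟩ := hf
  obtain ⟨m, hm, ν', hν'⟩ := hg
  exact ⟨n + m, by omega, _, (hν.raise hn m).add (hν'.raise' hn m)⟩

/-- The bounded Stieltjes functions as a subalgebra. -/
def boundedStieltjesSubalgebra : Subalgebra ℂ (Set.Ioi (0 : ℝ) → ℂ) where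
  carrier := boundedStieltjes
  mul_mem' := mul_mem_boundedStieltjes
  add_mem' := add_mem_boundedStieltjes
  algebraMap_mem' c := ⟨1, le_rfl, c • VectorMeasure.dirac 0 1, by
    rw [Algebra.algebraMap_eq_smul_one]
    exact (represents_one 1).smul c⟩

/-! ### The functional calculus of a resolvent family -/

namespace IsResolventFamily

variable {X : Type*} [NormedAddCommGroup X] [NormedSpace ℂ X] [CompleteSpace X]
  {R : ℝ≥0 → X →L[ℂ] X}

/-- Both representations are raised to order `n + m`, one on each side, where the measures coincide.
The added factor `VectorMeasure.dirac 0 1` transforms to the identity. -/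
theorem transform_eq_of_represents (hR : IsResolventFamily R) {n m : ℕ} (hn : 1 ≤ n) (hm : 1 ≤ m)
    {ν ν' : ComplexMeasure ℝ≥0} {f : Set.Ioi (0 : ℝ) → ℂ} (h : Represents n ν f)
    (h' : Represents m ν' f) : hR.transform n ν = hR.transform m ν' := by
  have e := (h.raise hn m).measure_unique (by omega) (h'.raise' hn m)
  have e1 := hR.transform_mulMeasure hn m ν (VectorMeasure.dirac 0 1)
  have e2 := hR.transform_mulMeasure hn m (VectorMeasure.dirac 0 1) ν'
  rw [transform_dirac] at e1 e2
  rw [mul_one] at e1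
  rw [one_mul] at e2
  rw [← e1, ← e2, e]

/-- The operator `f(A)` attached to a bounded Stieltjes function. -/
noncomputable def calculusFun (hR : IsResolventFamily R) (f : boundedStieltjesSubalgebra) :
    X →L[ℂ] X :=
  hR.transform f.2.choose f.2.choose_spec.2.choose

theorem calculusFun_eq (hR : IsResolventFamily R) {n : ℕ} (hn : 1 ≤ n) {ν : ComplexMeasure ℝ≥0}
    {f : boundedStieltjesSubalgebra} (h : Represents n ν (f : Set.Ioi (0 : ℝ) → ℂ)) :
    hR.calculusFun f = hR.transform n ν :=
  hR.transform_eq_of_represents f.2.choose_spec.1 hn f.2.choose_spec.2.choose_spec h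

theorem exists_represents (f : boundedStieltjesSubalgebra) :
    ∃ n, 1 ≤ n ∧ ∃ ν, Represents n ν (f : Set.Ioi (0 : ℝ) → ℂ) :=
  f.2

/-- The Stieltjes calculus as a unital algebra homomorphism. -/
noncomputable def calculus (hR : IsResolventFamily R) :
    boundedStieltjesSubalgebra →ₐ[ℂ] (X →L[ℂ] X) :=
  AlgHom.ofLinearMap
    { toFun := hR.calculusFun
      map_add' := fun f g => by
        obtain ⟨n, hn, ν, hν⟩ := exists_represents f
        obtain ⟨m, hm, ν', hν'⟩ := exists_represents g
        have h := (hν.raise hn m).add (hν'.raise' hn m)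
        rw [hR.calculusFun_eq (f := f + g) (by omega) h, hR.transform_add,
          ← hR.calculusFun_eq (by omega) (hν.raise hn m),
          ← hR.calculusFun_eq (by omega) (hν'.raise' hn m)]
      map_smul' := fun c f => by
        obtain ⟨n, hn, ν, hν⟩ := exists_represents f
        rw [hR.calculusFun_eq (f := c • f) hn (hν.smul c), hR.transform_smul,
          ← hR.calculusFun_eq hn hν, RingHom.id_apply] }
    (by
      change hR.calculusFun 1 = 1
      rw [hR.calculusFun_eq le_rfl (represents_one 1), transform_dirac])
    (fun f g => by
      change hR.calculusFun (f * g) = hR.calculusFun f * hR.calculusFun g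
      obtain ⟨n, hn, ν, hν⟩ := exists_represents f
      obtain ⟨m, hm, ν', hν'⟩ := exists_represents g
      rw [hR.calculusFun_eq (f := f * g) (by omega) (hν.mul hn hν'), hR.transform_mulMeasure hn,
        hR.calculusFun_eq hn hν, hR.calculusFun_eq hm hν'])

theorem calculus_eq (hR : IsResolventFamily R) {n : ℕ} (hn : 1 ≤ n) {ν : ComplexMeasure ℝ≥0}
    {f : boundedStieltjesSubalgebra} (h : Represents n ν (f : Set.Ioi (0 : ℝ) → ℂ)) :
    hR.calculus f = hR.transform n ν :=
  hR.calculusFun_eq hn h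

end IsResolventFamily

/-! ### Sectorial operators -/

namespace IsSectorial

variable {X : Type*} [NormedAddCommGroup X] [NormedSpace ℂ X] {A : X →ₗ.[ℂ] X}

theorem affine_apply (a b : ℂ) (x : A.domain) : affine a b A x = a • (x : X) + b • A x :=
  rfl

/-- `1 + sA = -s (-1/s - A)`, and `-1/s` is a negative number, hence outside the spectrum. -/
theorem isBoundedInverse_res (hA : IsSectorial A) {s : ℝ≥0} (hs : s ≠ 0) :
    IsBoundedInverse (affine 1 (s : ℝ) A) (res A s) := by
  have hs0 : (0 : ℝ) < s := by exact_mod_cast pos_iff_ne_zero.2 hs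
  have hsc : ((s : ℝ) : ℂ) ≠ 0 := by exact_mod_cast hs0.ne'
  have hex : ∃ R : X →L[ℂ] X, IsBoundedInverse (affine 1 (s : ℝ) A) R := by
    have hmem : (((-(s : ℝ)⁻¹ : ℝ)) : ℂ) ∉ opSpectrum A := fun h =>
      hA.spectrum_subset _ h ⟨_, neg_lt_zero.2 (inv_pos.2 hs0), rfl⟩
    obtain ⟨R, hR⟩ := not_not.1 hmem
    have key : ∀ x : A.domain, affine (((-(s : ℝ)⁻¹ : ℝ)) : ℂ) (-1) A x =
        -((s : ℝ) : ℂ)⁻¹ • affine 1 (s : ℝ) A x := fun x => by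
      rw [affine_apply, affine_apply, smul_add, smul_smul, smul_smul]
      push_cast
      rw [mul_one, neg_mul, inv_mul_cancel₀ hsc]
    refine ⟨-((s : ℝ) : ℂ)⁻¹ • R, fun x => ?_, fun y => ?_⟩
    · rw [smul_apply, ← map_smul]
      exact (congrArg R (key x)).symm.trans (hR.1 x)
    · obtain ⟨x, hx, hxy⟩ := hR.2 (-((s : ℝ) : ℂ)⁻¹ • y)
      refine ⟨x, by rw [smul_apply, ← map_smul]; exact hx, ?_⟩
      have h := (key x).symm.trans hxy
      exact smul_right_injective X (neg_ne_zero.2 (inv_ne_zero hsc)) h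
  rw [res, if_neg hs, dif_pos hex]
  exact hex.choose_spec

theorem res_zero : res A 0 = 1 := by
  rw [res, if_pos rfl]

theorem res_apply_add (hA : IsSectorial A) {s : ℝ≥0} (hs : s ≠ 0) (x : A.domain) :
    res A s x + ((s : ℝ) : ℂ) • res A s (A x) = x := by
  have h := (hA.isBoundedInverse_res hs).1 x
  erw [affine_apply] at h
  rwa [one_smul, map_add, map_smul] at h

theorem exists_res_apply_eq (hA : IsSectorial A) {s : ℝ≥0} (hs : s ≠ 0) (y : X) :
    ∃ x : A.domain, res A s y = x ∧ x + ((s : ℝ) : ℂ) • A x = y := by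
  obtain ⟨x, hx, hxy⟩ := (hA.isBoundedInverse_res hs).2 y
  erw [affine_apply, one_smul] at hxy
  exact ⟨x, hx, hxy⟩

theorem exists_norm_res_le (hA : IsSectorial A) : ∃ M : ℝ, ∀ s, ‖res A s‖ ≤ M := by
  obtain ⟨M, hM⟩ := hA.bounded
  refine ⟨max M ‖(1 : X →L[ℂ] X)‖, fun s => ?_⟩
  rcases eq_or_ne s 0 with rfl | hs
  · rw [res_zero]
    exact le_max_right _ _
  · exact (hM s (pos_iff_ne_zero.2 hs)).trans (le_max_left _ _)

/-- On the domain, `res A s y - y = -s res A s (A y)` is `O(s)`; density and the uniform bound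
extend the convergence to `X`. -/
theorem tendsto_res_apply_zero (hA : IsSectorial A) (x : X) :
    Filter.Tendsto (fun s => res A s x) (nhds 0) (nhds x) := by
  obtain ⟨M, hM⟩ := hA.exists_norm_res_le
  have hM0 : 0 ≤ M := (norm_nonneg _).trans (hM 0)
  have hdom : ∀ (y : A.domain) (s : ℝ≥0), ‖res A s y - y‖ ≤ s * (M * ‖A y‖) := by
    intro y s
    rcases eq_or_ne s 0 with rfl | hs
    · simp [res_zero]
    have h2 : res A s y - y = -(((s : ℝ) : ℂ) • res A s (A y)) := by
      nth_rw 2 [← hA.res_apply_add hs y]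
      abel
    rw [h2, norm_neg, norm_smul, Complex.norm_real, NNReal.norm_eq]
    exact mul_le_mul_of_nonneg_left (((res A s).le_opNorm _).trans
      (mul_le_mul_of_nonneg_right (hM s) (norm_nonneg _))) s.2
  rw [Metric.tendsto_nhds]
  intro ε hε
  obtain ⟨y, hy, hxy⟩ := hA.dense_domain.exists_dist_lt x
    (show 0 < ε / (2 * (M + 1)) by positivity)
  have hlim : Filter.Tendsto (fun s : ℝ≥0 => (s : ℝ) * (M * ‖A ⟨y, hy⟩‖)) (nhds 0) (nhds 0) := by
    have : Continuous fun s : ℝ≥0 => (s : ℝ) * (M * ‖A ⟨y, hy⟩‖) := by fun_prop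
    simpa using this.tendsto 0
  filter_upwards [hlim.eventually_lt_const (half_pos hε)] with s hs
  rw [dist_eq_norm] at hxy ⊢
  have e : res A s x - x = res A s (x - y) + (res A s y - y) - (x - y) := by
    rw [map_sub]
    abel
  have h3 : ‖res A s (x - y)‖ ≤ M * ‖x - y‖ :=
    ((res A s).le_opNorm _).trans (mul_le_mul_of_nonneg_right (hM s) (norm_nonneg _))
  have h4 : (M + 1) * ‖x - y‖ < ε / 2 := by
    rw [lt_div_iff₀ (by positivity)] at hxy
    linarith
  rw [e]
  calc _ ≤ ‖res A s (x - y) + (res A s y - y)‖ + ‖x - y‖ := norm_sub_le _ _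
    _ ≤ ‖res A s (x - y)‖ + ‖res A s y - y‖ + ‖x - y‖ := by gcongr; exact norm_add_le _ _
    _ < ε := by linarith [hdom ⟨y, hy⟩ s]

theorem isResolventFamily (hA : IsSectorial A) : IsResolventFamily (res A) where
  zero := res_zero
  identity s t := by
    rcases eq_or_ne s 0 with rfl | hs
    · simp [res_zero]
    rcases eq_or_ne t 0 with rfl | ht
    · simp [res_zero]
    ext y
    -- Writing `y = x + t A x` with `x = res A t y` reduces the identity to `res A s x + s res A s
    -- (A x) = x`.
    obtain ⟨x, hx, hxy⟩ := hA.exists_res_apply_eq ht y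
    have h2 : res A s y = res A s x + ((t : ℝ) : ℂ) • res A s (A x) := by
      rw [← hxy, map_add, map_smul]
    simp only [sub_apply, smul_apply, mul_apply_eq_comp]
    rw [h2, hx]
    nth_rw 1 [← hA.res_apply_add hs x]
    module
  bounded := hA.exists_norm_res_le
  tendsto_zero := hA.tendsto_res_apply_zero

end IsSectorial

end StieltjesCalculus

theorem proposition4p6 {X : Type*} [NormedAddCommGroup X] [NormedSpace ℂ X] [CompleteSpace X]
    (A : X →ₗ.[ℂ] X) (hA : StieltjesCalculus.IsSectorial A) :
    ∃ 𝒜 : Subalgebra ℂ (Set.Ioi (0 : ℝ) → ℂ),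
      (𝒜 : Set (Set.Ioi (0 : ℝ) → ℂ)) = StieltjesCalculus.boundedStieltjes ∧
      ∃! S : 𝒜 →ₐ[ℂ] (X →L[ℂ] X),
        ∀ (n : ℕ) (ν : ComplexMeasure ℝ≥0) (f : 𝒜), 1 ≤ n →
          StieltjesCalculus.Represents n ν (f : Set.Ioi (0 : ℝ) → ℂ) →
          ∀ x : X,
            ν.Integrable (fun s => ((StieltjesCalculus.res A s) ^ n) x) ∧
            S f x =
              StieltjesCalculus.cintegral ν fun s => ((StieltjesCalculus.res A s) ^ n) x := by
  have hR := hA.isResolventFamily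
  refine ⟨StieltjesCalculus.boundedStieltjesSubalgebra, rfl, hR.calculus, ?_, fun S hS => ?_⟩
  · intro n ν f hn hf x
    exact ⟨hR.integrable_pow_apply ν n x, by rw [hR.calculus_eq hn hf, hR.transform_apply]⟩
  · ext f x
    obtain ⟨n, hn, ν, hν⟩ := StieltjesCalculus.IsResolventFamily.exists_represents f
    rw [(hS n ν f hn hν x).2, hR.calculus_eq hn hν, hR.transform_apply]
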